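/- **Model.** A finite set of $L$ ports, divided into ingress and egress ports, is given; port $\ell$ has capacity $b_\ell>0$. A finite set of flows is partitioned into finitely many nonempty coflows $k$ with weights $w_k\ge 0$; each flow $f$ has one ingress port, one egress port and a random volume $V_f>0$ (almost surely). For a port $\ell$ and a coflow $k$ let $P_{\ell,k}=\frac1{b_\ell}\sum_f V_f$, the sum being over the flows $f$ of $k$ that use $\ell$, and let $\mu_{\ell,k}=\mathbb E[P_{\ell,k}]$. *Policies.* A non-anticipative policy $r$ chooses, at time $0$ and at each flow completion time, nonnegative rates for the unfinished flows whose sum at each port $\ell$ is at most $b_\ell$; the rates stay constant until the next flow completion, and depend only on the completion times and sets of finished flows up to now. $C_k(r)$ is the time at which the last flow of coflow $k$ finishes. The policy $r$ is *order-based* if no port ever transmits two flows at the same time and there is a partial order on the flows, in which any two flows with a common port are comparable, such that on every port the flows complete in this order, whatever the (positive) volumes are. Let $C^{OPT}=\inf_r\sum_k w_k\,\mathbb E[C_k(r)]$ over all order-based policies $r$. *Sincronia-based priority policy.* Start with $A$ the set of all coflows and the given weights $w$. While $A\ne\emptyset$: choose a bottleneck port $b$ maximizing $\sum_{k\in A}\mu_{b,k}$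 and a coflow $k^*\in A$ minimizing $w_k/\mu_{b,k}$ (equal to $+\infty$ if $\mu_{b,k}=0$); replace $w_k$ by $w_k-w_{k^*}\mu_{b,k}/\mu_{b,k^*}$ for all $k\in A$; give $k^*$ the lowest priority not yet assigned; remove $k^*$ from $A$. Ties are broken arbitrarily. Then, at time $0$ and at each flow completion, the unfinished flows are scanned by the priority of their coflow (in any fixed order within a coflow), and each scanned flow receives the full rate still available at both of its ports (so if all capacities are equal, it gets the full rate of its two ports when both are free and rate $0$ otherwise). Let $C_k$ be the resulting completion times. **Statement.** Suppose that for each port $\ell$ the variables $P_{\ell,k}$, $k$ ranging over the coflows, are independent (as is the case when the flow volumes are independent), and that $P_{\ell,k}$ is gamma-distributed whenever some flow of $k$ uses $\ell$. Put $\sigma_{\max}^2=\max_{\ell,k}\operatorname{Var}(P_{\ell,k})$, $\mu_{\min}=\min\{\mu_{\ell,k}:\mu_{\ell,k}\ne0\}$, $\gamma=(\sigma_{\max}/\mu_{\min})^2$ and $c=1+\gamma\log L$. Then $$\sum_k w_k\,\mathbb E[C_k]\;\le\;4\Bigl(c+\log\bigl(c+\sqrt{c^2-1}\bigr)\Bigr)\,C^{OPT}.$$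 -/

import Mathlib

open MeasureTheory ProbabilityTheory
open scoped ENNReal

noncomputable section

namespace Coflow

/-- A coflow instance on a big switch: ports with capacities, flows with an ingress port and an
egress port, coflows (the nonempty classes of flows with the same owner) and their weights.
Flow volumes are not part of the instance. -/
structure Network (Port Cof Flow : Type*) where
  cap : Port → ℝ
  cap_pos : ∀ l, 0 < cap l
  src : Flow → Port
  dst : Flow → Port
  /-- ingress ports and egress ports are different ports -/
  src_ne_dst : ∀ f g, src f ≠ dst g
  owner : Flow → Cof
  /-- every coflow has at least one flow -/
  owner_surjective : Function.Surjective owner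
  weight : Cof → ℝ
  weight_nonneg : ∀ k, 0 ≤ weight k

variable {Port Cof Flow : Type*}

/-- Flow `f` uses port `l`, as its ingress or as its egress port. -/
def Network.Uses (N : Network Port Cof Flow) (f : Flow) (l : Port) : Prop :=
  N.src f = l ∨ N.dst f = l

open Classical in
/-- The transmission time `P_{l,k}` of coflow `k` at port `l` in isolation, for the volumes `v`. -/
def Network.procTime [Fintype Flow] (N : Network Port Cof Flow) (v : Flow → ℝ)
    (l : Port) (k : Cof) : ℝ :=
  (∑ f with N.owner f = k ∧ N.Uses f l, v f) / N.cap l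

/-! ### Non-anticipative rate allocation policies -/

open Classical in
/-- A non-anticipative rate-allocation policy. Decision epochs are time `0` and the flow completion
times; rates are constant between them. `rate past now fin f` is the rate given to flow `f` from
the epoch `now` on, when `fin` is the set of flows finished by then and `past` lists the earlier
epochs, most recent first, each with the flows that were finished at it. -/
structure Policy [Fintype Flow] (N : Network Port Cof Flow) where
  rate : List (ℝ × Finset Flow) → ℝ → Finset Flow → Flow → ℝ
  rate_nonneg : ∀ past now fin f, 0 ≤ rate past now fin f
  rate_finished : ∀ past now fin f, f ∈ fin → rate past now fin f = 0
  capacity : ∀ past now fin l, ∑ f with N.Uses f l, rate past now fin f ≤ N.cap l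

/-- The state of the system at a decision epoch: the earlier epochs, the current time, and the
remaining volumes. -/
structure State (Flow : Type*) where
  past : List (ℝ × Finset Flow)
  now : ℝ
  rem : Flow → ℝ

open Classical in
/-- The set of finished flows. -/
def State.finished [Fintype Flow] (s : State Flow) : Finset Flow :=
  {f | s.rem f ≤ 0}

section Dynamics

variable [Fintype Flow] {N : Network Port Cof Flow}

/-- The rates in force from the epoch `s` on. -/
def Policy.rateAt (r : Policy N) (s : State Flow) : Flow → ℝ :=
  r.rate s.past s.now s.finished

open Classical in
/-- The flows under transmission from the epoch `s` on. -/
def Policy.active (r : Policy N) (s : State Flow) : Finset Flow :=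
  {f | 0 < r.rateAt s f}

open Classical in
/-- The transition to the next decision epoch, the earliest completion of a flow under
transmission. If no flow is transmitted, no flow ever completes again and the state is kept. -/
def Policy.step (r : Policy N) (s : State Flow) : State Flow :=
  if h : (r.active s).Nonempty then
    let dt := (r.active s).inf' h fun f => s.rem f / r.rateAt s f
    { past := (s.now, s.finished) :: s.past
      now := s.now + dt
      rem := fun f => s.rem f - r.rateAt s f * dt }
  else s

/-- The state at the `n`-th decision epoch when the volumes are `v`. -/
def Policy.epoch (r : Policy N) (v : Flow → ℝ) (n : ℕ) : State Flow :=
  r.step^[n] { past := [], now := 0, rem := v }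

/-- The completion time of flow `f` when the volumes are `v` (`∞` if it never completes). -/
def Policy.flowCompletion (r : Policy N) (v : Flow → ℝ) (f : Flow) : ℝ≥0∞ :=
  ⨅ (n : ℕ) (_ : (r.epoch v n).rem f ≤ 0), ENNReal.ofReal (r.epoch v n).now

/-- The completion time `C_k` of coflow `k`: the completion time of its last flow. -/
def Policy.completion (r : Policy N) (v : Flow → ℝ) (k : Cof) : ℝ≥0∞ :=
  ⨆ (f : Flow) (_ : N.owner f = k), r.flowCompletion v f

/-- The weighted expected completion time `∑ w_k E[C_k]`. -/
def Policy.cost [Fintype Cof] {Ω : Type*} [MeasurableSpace Ω] (r : Policy N) (ν : Measure Ω)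
    (V : Flow → Ω → ℝ) : ℝ≥0∞ :=
  ∑ k, ENNReal.ofReal (N.weight k) * ∫⁻ ω, r.completion (fun f => V f ω) k ∂ν

/-- Order-based policies: no port ever transmits two flows at the same time, and there is a
(strict) partial order on the flows, in which any two distinct flows with a common port are
comparable, such that on every port the flows complete in this order, whatever the (positive)
flow volumes are. -/
def Policy.IsOrderBased (r : Policy N) : Prop :=
  (∀ past now fin l f g, N.Uses f l → N.Uses g l →
    0 < r.rate past now fin f → 0 < r.rate past now fin g → f = g) ∧
  ∃ prec : Flow → Flow → Prop, IsStrictOrder Flow prec ∧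
    (∀ f g l, f ≠ g → N.Uses f l → N.Uses g l → prec f g ∨ prec g f) ∧
    ∀ v : Flow → ℝ, (∀ f, 0 < v f) → ∀ f g l, N.Uses f l → N.Uses g l → prec f g →
      r.flowCompletion v f ≤ r.flowCompletion v g

/-- The optimal value over all order-based policies. -/
def optCost [Fintype Cof] {Ω : Type*} [MeasurableSpace Ω] (N : Network Port Cof Flow)
    (ν : Measure Ω) (V : Flow → Ω → ℝ) : ℝ≥0∞ :=
  ⨅ (r : Policy N) (_ : r.IsOrderBased), r.cost ν V

end Dynamics

/-! ### The greedy rate allocation -/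

open Classical in
/-- Greedy rates: the flows are scanned in the order of the list, and each one receives the full
rate that its two ports still have available (`res` holds the residual capacities). If all ports
have the same capacity, then each scanned flow receives the full rate of its ports when both are
free, and nothing otherwise. -/
def greedyRate (N : Network Port Cof Flow) : List Flow → (Port → ℝ) → Flow → ℝ
  | [], _ => fun _ => 0
  | f :: fs, res =>
    let x := min (res (N.src f)) (res (N.dst f))
    Function.update (greedyRate N fs fun l => if N.Uses f l then res l - x else res l) f x

lemma greedyRate_of_notMem (N : Network Port Cof Flow) (fs : List Flow) (res : Port → ℝ)
    (f : Flow) (hf : f ∉ fs) : greedyRate N fs res f = 0 := by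
  classical
  induction fs generalizing res with
  | nil => rfl
  | cons g gs ih =>
    simp only [List.mem_cons, not_or] at hf
    simp only [greedyRate]
    rw [Function.update_apply, if_neg hf.1]
    exact ih _ hf.2

lemma residual_nonneg (N : Network Port Cof Flow) (f : Flow) (res : Port → ℝ)
    (h : ∀ l, 0 ≤ res l) (l : Port) [Decidable (N.Uses f l)] :
    0 ≤ if N.Uses f l then res l - min (res (N.src f)) (res (N.dst f)) else res l := by
  split_ifs with hu
  · rcases hu with rfl | rfl
    · exact sub_nonneg.2 (min_le_left _ _)
    · exact sub_nonneg.2 (min_le_right _ _)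
  · exact h l

lemma greedyRate_nonneg (N : Network Port Cof Flow) (fs : List Flow) (res : Port → ℝ)
    (h : ∀ l, 0 ≤ res l) (f : Flow) : 0 ≤ greedyRate N fs res f := by
  classical
  induction fs generalizing res with
  | nil => exact le_rfl
  | cons g gs ih =>
    simp only [greedyRate]
    by_cases hfg : f = g
    · subst hfg
      rw [Function.update_self]
      exact le_min (h _) (h _)
    · rw [Function.update_of_ne hfg]
      exact ih _ fun l => residual_nonneg N g res h l

open Classical in
lemma greedyRate_capacity [Fintype Flow] (N : Network Port Cof Flow) (fs : List Flow)
    (res : Port → ℝ) (h : ∀ l, 0 ≤ res l) (l : Port) :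
    ∑ f with N.Uses f l, greedyRate N fs res f ≤ res l := by
  induction fs generalizing res with
  | nil => simpa [greedyRate] using h l
  | cons g gs ih =>
    have hres := fun l => residual_nonneg N g res h l
    have hih := ih _ hres
    have hnn := greedyRate_nonneg N gs _ hres
    simp only [greedyRate]
    by_cases hg : N.Uses g l
    · have hmem : g ∈ Finset.univ.filter fun f => N.Uses f l := by simpa using hg
      rw [Finset.sum_update_of_mem hmem]
      rw [← Finset.add_sum_erase _ _ hmem, Finset.erase_eq, if_pos hg] at hih
      linarith [hnn g]
    · rw [Finset.sum_update_of_notMem (by simpa using hg)]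
      simpa [hg] using hih

open Classical in
/-- The preemptive greedy rate allocation for the priority list `order` of flows: at every decision
epoch the unfinished flows are served greedily in the order of the list. -/
def greedyPolicy [Fintype Flow] (N : Network Port Cof Flow) (order : List Flow) : Policy N where
  rate _ _ fin := greedyRate N (order.filter fun f => f ∉ fin) N.cap
  rate_nonneg _ _ _ f := greedyRate_nonneg N _ _ (fun l => (N.cap_pos l).le) f
  rate_finished _ _ fin f hf := greedyRate_of_notMem N _ _ f (by simp [hf])
  capacity _ _ _ l := greedyRate_capacity N _ _ (fun l => (N.cap_pos l).le) l

/-! ### The Sincronia ordering -/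

open Classical in
/-- `SincroniaRun μ w A π`: the Sincronia primal-dual algorithm with processing times `μ`, started
with current weights `w` and set `A` of unscheduled coflows, can output the priority order `π` of
`A` (highest priority first). Each iteration picks a bottleneck port `b` and a coflow `k` in `A`
minimizing `w k / μ b k` (which is `+∞` if `μ b k = 0`), and gives `k` the lowest remaining
priority. Ties may be broken in any way. -/
inductive SincroniaRun (μ : Port → Cof → ℝ) : (Cof → ℝ) → Finset Cof → List Cof → Prop
  | done (w : Cof → ℝ) : SincroniaRun μ w ∅ []
  | step (w : Cof → ℝ) (A : Finset Cof) (b : Port) (k : Cof) (π : List Cof)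
      (bottleneck : ∀ l, ∑ j ∈ A, μ l j ≤ ∑ j ∈ A, μ b j)
      (mem : k ∈ A) (pos : 0 < μ b k)
      (argmin : ∀ j ∈ A, 0 < μ b j → w k / μ b k ≤ w j / μ b j)
      (rest : SincroniaRun μ (fun j => if j ∈ A then w j - w k * μ b j / μ b k else w j)
        (A.erase k) π) :
      SincroniaRun μ w A (π ++ [k])

/-- `order` lists all flows exactly once, by the priority `π` of their coflows; the order of the
flows of one coflow is arbitrary. -/
def IsFlowOrder [DecidableEq Cof] (N : Network Port Cof Flow) (π : List Cof)
    (order : List Flow) : Prop :=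
  order.Nodup ∧ (∀ f, f ∈ order) ∧
    order.Pairwise fun f g => π.idxOf (N.owner f) ≤ π.idxOf (N.owner g)

/-! ### Moments of the processing times -/

section Moments

variable [Fintype Flow] {Ω : Type*} [MeasurableSpace Ω]

/-- The expected processing time `μ_{l,k}`. -/
def meanTime (N : Network Port Cof Flow) (ν : Measure Ω) (V : Flow → Ω → ℝ)
    (l : Port) (k : Cof) : ℝ :=
  ∫ ω, N.procTime (fun f => V f ω) l k ∂ν

/-- The smallest nonzero expected processing time (there are finitely many). -/
def minMean (N : Network Port Cof Flow) (ν : Measure Ω) (V : Flow → Ω → ℝ) : ℝ :=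
  sInf {m | ∃ l k, m = meanTime N ν V l k ∧ m ≠ 0}

/-- The largest variance of a processing time (there are finitely many). -/
def maxVariance (N : Network Port Cof Flow) (ν : Measure Ω) (V : Flow → Ω → ℝ) : ℝ :=
  sSup {s | ∃ l k, s = variance (fun ω => N.procTime (fun f => V f ω) l k) ν}

/-- `γ = (σ_max / μ_min)²`. -/
def gammaParam (N : Network Port Cof Flow) (ν : Measure Ω) (V : Flow → Ω → ℝ) : ℝ :=
  maxVariance N ν V / minMean N ν V ^ 2

end Moments

end Coflow

end

/-! Let M_k be the largest, over the ports, of the mean load of the coflows with priority at least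
that of k. The bound is a product of three factors.

Factor 2, primal-dual. Under an order-based policy, which coflows are finished at a port no later
than k is decided by the order and not by the volumes. So E[C_k] is at least the mean load T_k of
these coflows, maximized over the ports, and the T_k satisfy the parallel inequalities (∑_B μ)² ≤ 2
∑_B μ T at every port. Each Sincronia iteration takes a multiple of the bottleneck's means off the
weights, and the parallel inequality at that port pays for it. This gives ∑ w M ≤ 2 ∑ w T
(`SincroniaRun.weighted_load_le`).

Factor 2, two ports. While a flow is unfinished, the greedy rates fill one of its two ports with
flows of no lower priority, so C_k is at most twice the largest random load of the same prefix
(`greedyPolicy_flowCompletion_le`).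

Factor c + log(c + √(c² - 1)), the price of taking the maximum over ports inside the expectation. A
gamma time has scale variance/mean ≤ b = σ_max²/μ_min, so by independence each prefix load has
moment generating function at most (1 - bt)^(-M/b). The expected maximum of L such loads is at most
log(L (1 - bt)^(-M/b))/t (`lintegral_le_of_mgf_le`), and an explicit t gives the constant
(`log_mul_rpow_div_le`). -/

noncomputable section

namespace Coflow

/-! ### Moments and moment generating function of the gamma law. -/

section GammaMoments

lemma integrable_gammaPDFReal {a r : ℝ} (ha : 0 < a) (hr : 0 < r) :
    Integrable (gammaPDFReal a r) := by
  refine ⟨by fun_prop, ?_⟩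
  rw [hasFiniteIntegral_iff_ofReal (Filter.Eventually.of_forall (gammaPDFReal_nonneg ha hr))]
  exact (lintegral_gammaPDF_eq_one ha hr).trans_lt ENNReal.one_lt_top

lemma integral_gammaPDFReal {a r : ℝ} (ha : 0 < a) (hr : 0 < r) :
    ∫ x, gammaPDFReal a r x = 1 := by
  rw [integral_eq_lintegral_of_nonneg_ae
    (Filter.Eventually.of_forall (gammaPDFReal_nonneg ha hr)) (by fun_prop)]
  change (∫⁻ x, gammaPDF a r x).toReal = 1
  rw [lintegral_gammaPDF_eq_one ha hr, ENNReal.toReal_one]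

/-- Integrating a function that turns one gamma density into a multiple of another. -/
lemma integral_gammaMeasure_of_mul_eq {a r a' r' C : ℝ} (ha : 0 < a) (hr : 0 < r) (ha' : 0 < a')
    (hr' : 0 < r') (g : ℝ → ℝ)
    (h : ∀ x, 0 < x → gammaPDFReal a r x * g x = C * gammaPDFReal a' r' x) :
    Integrable g (gammaMeasure a r) ∧ ∫ x, g x ∂gammaMeasure a r = C := by
  have hm : Measurable (gammaPDF a r) := (measurable_gammaPDFReal a r).ennreal_ofReal
  have hlt : ∀ᵐ x : ℝ, gammaPDF a r x < ∞ :=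
    Filter.Eventually.of_forall fun x => ENNReal.ofReal_lt_top
  have hae : (fun x => (gammaPDF a r x).toReal • g x) =ᵐ[volume]
      fun x => C * gammaPDFReal a' r' x := by
    have h0 : ∀ᵐ x : ℝ, x ≠ 0 := by simp [ae_iff]
    filter_upwards [h0] with x hx
    rw [gammaPDF, ENNReal.toReal_ofReal (gammaPDFReal_nonneg ha hr x), smul_eq_mul]
    rcases lt_or_gt_of_ne hx with hx | hx
    · simp [gammaPDFReal, not_le.2 hx]
    · exact h x hx
  constructor
  · rw [gammaMeasure, integrable_withDensity_iff_integrable_smul' hm hlt]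
    exact ((integrable_gammaPDFReal ha' hr').const_mul C).congr hae.symm
  · rw [gammaMeasure, integral_withDensity_eq_integral_toReal_smul hm hlt, integral_congr_ae hae,
      integral_const_mul, integral_gammaPDFReal ha' hr', mul_one]

lemma integral_id_gammaMeasure {a r : ℝ} (ha : 0 < a) (hr : 0 < r) :
    Integrable (fun x => x) (gammaMeasure a r) ∧ ∫ x, x ∂gammaMeasure a r = a / r := by
  refine integral_gammaMeasure_of_mul_eq ha hr (by linarith : 0 < a + 1) hr _ fun x hx => ?_
  have h1 := Real.Gamma_pos_of_pos ha
  simp only [gammaPDFReal, hx.le, if_true]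
  rw [Real.Gamma_add_one ha.ne', Real.rpow_add_one hr.ne', add_sub_cancel_right,
    Real.rpow_sub_one hx.ne']
  field_simp

lemma integral_sq_gammaMeasure {a r : ℝ} (ha : 0 < a) (hr : 0 < r) :
    Integrable (fun x => x ^ 2) (gammaMeasure a r) ∧
      ∫ x, x ^ 2 ∂gammaMeasure a r = a * (a + 1) / r ^ 2 := by
  refine integral_gammaMeasure_of_mul_eq ha hr (by linarith : 0 < a + 1 + 1) hr _ fun x hx => ?_
  have h1 := Real.Gamma_pos_of_pos ha
  simp only [gammaPDFReal, hx.le, if_true]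
  rw [Real.Gamma_add_one (by linarith), Real.Gamma_add_one ha.ne', Real.rpow_add_one hr.ne',
    Real.rpow_add_one hr.ne', add_sub_cancel_right, Real.rpow_add_one hx.ne',
    Real.rpow_sub_one hx.ne']
  field_simp

lemma integral_exp_gammaMeasure {a r t : ℝ} (ha : 0 < a) (hr : 0 < r) (ht : t < r) :
    Integrable (fun x => Real.exp (t * x)) (gammaMeasure a r) ∧
      ∫ x, Real.exp (t * x) ∂gammaMeasure a r = (r / (r - t)) ^ a := by
  refine integral_gammaMeasure_of_mul_eq ha hr ha (sub_pos.2 ht) _ fun x hx => ?_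
  have h1 := Real.Gamma_pos_of_pos ha
  have h2 := Real.rpow_pos_of_pos (sub_pos.2 ht) a
  simp only [gammaPDFReal, hx.le, if_true]
  rw [Real.div_rpow hr.le (sub_pos.2 ht).le, mul_assoc, ← Real.exp_add,
    show -(r * x) + t * x = -((r - t) * x) by ring]
  field_simp

variable {Ω : Type*} [MeasurableSpace Ω] {ν : Measure Ω}
  {X : Ω → ℝ} {s β : ℝ}

lemma integrable_of_map_gamma (hX : Measurable X) (hs : 0 < s) (hβ : 0 < β)
    (h : ν.map X = gammaMeasure s (1 / β)) : Integrable X ν := by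
  have := (integral_id_gammaMeasure hs (one_div_pos.2 hβ)).1
  rw [← h] at this
  exact this.comp_measurable hX

lemma integral_of_map_gamma (hX : Measurable X) (hs : 0 < s) (hβ : 0 < β)
    (h : ν.map X = gammaMeasure s (1 / β)) : ∫ ω, X ω ∂ν = s * β := by
  have := (integral_id_gammaMeasure hs (one_div_pos.2 hβ)).2
  rw [← h, integral_map hX.aemeasurable (by fun_prop)] at this
  rw [this, div_div_eq_mul_div, div_one]

lemma variance_of_map_gamma [IsProbabilityMeasure ν] (hX : Measurable X) (hs : 0 < s) (hβ : 0 < β)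
    (h : ν.map X = gammaMeasure s (1 / β)) : variance X ν = s * β ^ 2 := by
  have h2 := integral_sq_gammaMeasure hs (one_div_pos.2 hβ)
  rw [← h, integral_map hX.aemeasurable (by fun_prop)] at h2
  have hL : MemLp X 2 ν := (memLp_two_iff_integrable_sq hX.aestronglyMeasurable).2
    (h2.1.comp_measurable hX)
  rw [variance_eq_sub hL, integral_of_map_gamma hX hs hβ h]
  simp only [Pi.pow_apply]
  rw [h2.2]
  field_simp
  ring

lemma mgf_of_map_gamma {t : ℝ} (hX : Measurable X) (hs : 0 < s) (hβ : 0 < β)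
    (h : ν.map X = gammaMeasure s (1 / β)) (ht : β * t < 1) :
    Integrable (fun ω => Real.exp (t * X ω)) ν ∧ mgf X ν t = (1 - β * t) ^ (-s) := by
  have ht' : t < 1 / β := by rwa [lt_div_iff₀ hβ, mul_comm]
  have h2 := integral_exp_gammaMeasure hs (one_div_pos.2 hβ) ht'
  rw [← h, integral_map hX.aemeasurable (by fun_prop)] at h2
  refine ⟨h2.1.comp_measurable hX, ?_⟩
  rw [mgf, h2.2, Real.rpow_neg (by linarith), ← Real.inv_rpow (by linarith)]
  congr 1
  have : 1 - β * t ≠ 0 := by linarith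
  have : 1 - t * β ≠ 0 := by linarith
  field_simp

/-- The moment generating function of a gamma variable grows with the scale when the mean is
kept. -/
lemma mgf_gamma_le_of_scale_le {t b : ℝ} (hX : Measurable X) (hs : 0 < s) (hβ : 0 < β)
    (h : ν.map X = gammaMeasure s (1 / β)) (hb : β ≤ b) (ht0 : 0 ≤ t) (ht : b * t < 1) :
    mgf X ν t ≤ (1 - b * t) ^ (-(∫ ω, X ω ∂ν) / b) := by
  have hb0 := hβ.trans_le hb
  have hβt : β * t ≤ b * t := mul_le_mul_of_nonneg_right hb ht0
  rw [(mgf_of_map_gamma hX hs hβ h (hβt.trans_lt ht)).2, integral_of_map_gamma hX hs hβ h]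
  -- Bernoulli's inequality with exponent β/b ≤ 1: (1 - bt)^(β/b) ≤ 1 - βt.
  have key := rpow_one_add_le_one_add_mul_self (s := -(b * t)) (by linarith)
    (div_nonneg hβ.le hb0.le) ((div_le_one hb0).2 hb)
  have e : 1 + β / b * -(b * t) = 1 - β * t := by field_simp; ring
  rw [e, ← sub_eq_add_neg] at key
  have hp : 0 < (1 - b * t) ^ (β / b) := Real.rpow_pos_of_pos (by linarith) _
  calc (1 - β * t) ^ (-s) ≤ ((1 - b * t) ^ (β / b)) ^ (-s) :=
        Real.rpow_le_rpow_of_nonpos hp key (by linarith)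
    _ = _ := by
        rw [← Real.rpow_mul (by linarith)]
        congr 1
        ring

end GammaMoments

/-! ### Primal-dual analysis of the Sincronia order. -/

section Sincronia

variable {Port Cof : Type*} {μ : Port → Cof → ℝ}

open Classical in
lemma SincroniaRun.nodup_and_mem_iff {w : Cof → ℝ} {A : Finset Cof} {π : List Cof}
    (h : SincroniaRun μ w A π) : π.Nodup ∧ ∀ k, k ∈ π ↔ k ∈ A := by
  induction h with
  | done w => simp
  | step w A b k π _ mem _ _ _ ih =>
    refine ⟨?_, fun j => ?_⟩
    · rw [List.nodup_append]
      refine ⟨ih.1, List.nodup_singleton k, fun a ha c hc => ?_⟩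
      rw [ih.2] at ha
      rw [List.mem_singleton.1 hc]
      exact Finset.ne_of_mem_erase ha
    · rw [List.mem_append, ih.2, List.mem_singleton, Finset.mem_erase]
      by_cases hj : j = k
      · simp [hj, mem]
      · simp [hj]

open Classical in
/-- The primal-dual guarantee: the weighted loads in the order found by the algorithm are at most
twice the weighted value of any solution of the parallel inequalities. -/
lemma SincroniaRun.weighted_load_le (hμ : ∀ l k, 0 ≤ μ l k) {w : Cof → ℝ} {A : Finset Cof}
    {π : List Cof} (h : SincroniaRun μ w A π) (hw : ∀ k ∈ A, 0 ≤ w k) (T M : Cof → ℝ)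
    (hT : ∀ l, ∀ B : Finset Cof, (∑ k ∈ B, μ l k) ^ 2 ≤ 2 * ∑ k ∈ B, μ l k * T k)
    (hM : ∀ k ∈ A, ∃ l, M k ≤ ∑ j ∈ A with π.idxOf j ≤ π.idxOf k, μ l j) :
    ∑ k ∈ A, w k * M k ≤ 2 * ∑ k ∈ A, w k * T k := by
  induction h with
  | done w => simp
  | step w A b k π bottleneck mem pos argmin rest ih =>
    have hπ := rest.nodup_and_mem_iff
    set θ := w k / μ b k with hθ
    have hθ0 : 0 ≤ θ := div_nonneg (hw k mem) pos.le
    -- The weights split into the reduced weights, which vanish at `k`, and θ times the means at the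
    -- bottleneck. Induction handles the first part, the parallel inequality at `b` the second.
    have hsplit : ∀ U : Cof → ℝ, ∑ j ∈ A, w j * U j =
        ∑ j ∈ A.erase k, (if j ∈ A then w j - w k * μ b j / μ b k else w j) * U j +
          θ * ∑ j ∈ A, μ b j * U j := by
      intro U
      rw [← Finset.add_sum_erase _ _ mem, ← Finset.add_sum_erase _ (fun j => μ b j * U j) mem,
        mul_add, Finset.mul_sum, add_left_comm, ← Finset.sum_add_distrib]
      congr 1
      · rw [hθ]; field_simp
      · refine Finset.sum_congr rfl fun j hj => ?_
        rw [if_pos (Finset.mem_of_mem_erase hj), hθ]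
        ring
    have hrest := ih (fun j hj => by
        beta_reduce
        have hjA := Finset.mem_of_mem_erase hj
        rw [if_pos hjA]
        rcases (hμ b j).eq_or_lt with h0 | h0
        · rw [← h0]; simpa using hw j hjA
        · have := (le_div_iff₀ h0).1 (argmin j hjA h0)
          rw [div_mul_eq_mul_div] at this
          linarith) (fun j hj => by
        obtain ⟨l, hl⟩ := hM j (Finset.mem_of_mem_erase hj)
        refine ⟨l, hl.trans (Finset.sum_le_sum_of_subset_of_nonneg ?_ fun _ _ _ => hμ _ _)⟩
        intro i hi
        rw [Finset.mem_filter] at hi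
        have hjπ : j ∈ π := (hπ.2 j).2 hj
        -- `k` comes last in the order, so it is in no prefix ending at another coflow, and the
        -- loads of those prefixes survive its removal.
        have hik : i ≠ k := by
          rintro rfl
          have hnot : i ∉ π := fun hm => Finset.notMem_erase i A ((hπ.2 i).1 hm)
          have := hi.2
          rw [List.idxOf_append_of_notMem hnot, List.idxOf_append_of_mem hjπ] at this
          have := List.idxOf_lt_length_of_mem hjπ
          omega
        have hiA := Finset.mem_erase.2 ⟨hik, hi.1⟩
        have := hi.2
        rw [List.idxOf_append_of_mem hjπ, List.idxOf_append_of_mem ((hπ.2 i).2 hiA)] at this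
        exact Finset.mem_filter.2 ⟨hiA, this⟩)
    beta_reduce at hrest
    have hMle : ∀ j ∈ A, M j ≤ ∑ i ∈ A, μ b i := fun j hj => by
      obtain ⟨l, hl⟩ := hM j hj
      exact (hl.trans (Finset.sum_le_sum_of_subset_of_nonneg (Finset.filter_subset _ _)
        fun _ _ _ => hμ _ _)).trans (bottleneck l)
    have hbM : ∑ j ∈ A, μ b j * M j ≤ (∑ j ∈ A, μ b j) ^ 2 := by
      rw [pow_two, Finset.sum_mul]
      exact Finset.sum_le_sum fun j hj => mul_le_mul_of_nonneg_left (hMle j hj) (hμ b j)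
    rw [hsplit M, hsplit T, mul_add]
    have := mul_le_mul_of_nonneg_left (hbM.trans (hT b A)) hθ0
    linarith

end Sincronia

/-! ### Parallel inequalities for loads along an order. -/

section ParallelInequalities

/-- Partial loads along a total relation satisfy the parallel inequalities. -/
lemma sq_sum_le_two_mul_sum_partial {Cof : Type*} [Fintype Cof] (m : Cof → ℝ) (hm : ∀ k, 0 ≤ m k)
    (R : Cof → Cof → Prop) [DecidableRel R]
    (hR : ∀ j k, 0 < m j → 0 < m k → R j k ∨ R k j) (T : Cof → ℝ)
    (hT : ∀ k, ∑ j with R j k, m j ≤ T k) (B : Finset Cof) :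
    (∑ k ∈ B, m k) ^ 2 ≤ 2 * ∑ k ∈ B, m k * T k := by
  have h1 : ∑ k ∈ B, ∑ j ∈ B, (if R j k then m k * m j else 0) ≤ ∑ k ∈ B, m k * T k := by
    refine Finset.sum_le_sum fun k _ => ?_
    refine le_trans ?_ (mul_le_mul_of_nonneg_left (hT k) (hm k))
    rw [Finset.mul_sum, ← Finset.sum_filter]
    exact Finset.sum_le_sum_of_subset_of_nonneg
      (Finset.filter_subset_filter _ (Finset.subset_univ B))
      fun i _ _ => mul_nonneg (hm k) (hm i)
  have h2 : ∑ k ∈ B, ∑ j ∈ B, (if R j k then m k * m j else 0) =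
      ∑ k ∈ B, ∑ j ∈ B, (if R k j then m k * m j else 0) := by
    rw [Finset.sum_comm]
    simp only [mul_comm]
  have h3 : (∑ k ∈ B, m k) ^ 2 ≤ ∑ k ∈ B, ∑ j ∈ B, (if R j k then m k * m j else 0) +
      ∑ k ∈ B, ∑ j ∈ B, (if R k j then m k * m j else 0) := by
    rw [pow_two, Finset.sum_mul_sum, ← Finset.sum_add_distrib]
    refine Finset.sum_le_sum fun k _ => ?_
    rw [← Finset.sum_add_distrib]
    refine Finset.sum_le_sum fun j _ => ?_
    have hkj := mul_nonneg (hm k) (hm j)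
    rcases (hm j).eq_or_lt with h0 | hj
    · simp [← h0]
    rcases (hm k).eq_or_lt with h0 | hk
    · simp [← h0]
    -- Each pair of positive means is counted in at least one of the two double sums; these are
    -- equal by symmetry, whence the factor 2.
    rcases hR j k hj hk with h | h
    · rw [if_pos h]; split_ifs <;> linarith
    · rw [if_pos h]; split_ifs <;> linarith
  linarith

end ParallelInequalities

/-! ### Dynamics of an arbitrary policy and the load lower bound. -/

section PolicyDynamics

variable {Port Cof Flow : Type*} [Fintype Flow] {N : Network Port Cof Flow} (r : Policy N)

/-- The time from the epoch `s` to the next one. -/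
def Policy.delay (s : State Flow) : ℝ :=
  if h : (r.active s).Nonempty then (r.active s).inf' h fun f => s.rem f / r.rateAt s f else 0

lemma Policy.step_now (s : State Flow) : (r.step s).now = s.now + r.delay s := by
  unfold Policy.step Policy.delay
  split_ifs <;> simp

lemma Policy.step_rem (s : State Flow) (f : Flow) :
    (r.step s).rem f = s.rem f - r.rateAt s f * r.delay s := by
  unfold Policy.step Policy.delay
  split_ifs <;> simp

lemma Policy.mem_active {s : State Flow} {f : Flow} : f ∈ r.active s ↔ 0 < r.rateAt s f := by
  simp [Policy.active]

lemma State.mem_finished {s : State Flow} {f : Flow} : f ∈ s.finished ↔ s.rem f ≤ 0 := by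
  simp [State.finished]

lemma Policy.rem_pos_of_active {s : State Flow} {f : Flow} (h : 0 < r.rateAt s f) :
    0 < s.rem f := by
  by_contra hf
  have := r.rate_finished s.past s.now s.finished f (State.mem_finished.2 (not_lt.1 hf))
  unfold Policy.rateAt at h
  linarith

lemma Policy.rateAt_nonneg (s : State Flow) (f : Flow) : 0 ≤ r.rateAt s f :=
  r.rate_nonneg _ _ _ f

lemma Policy.delay_nonneg (s : State Flow) : 0 ≤ r.delay s := by
  unfold Policy.delay
  split_ifs with h
  · rw [Finset.le_inf'_iff]
    intro f hf
    have h1 := r.mem_active.1 hf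
    exact div_nonneg (r.rem_pos_of_active h1).le h1.le
  · exact le_rfl

lemma Policy.rateAt_mul_delay_le (s : State Flow) {f : Flow} (hf : 0 < r.rateAt s f) :
    r.rateAt s f * r.delay s ≤ s.rem f := by
  have hm := r.mem_active.2 hf
  rw [Policy.delay, dif_pos ⟨f, hm⟩, mul_comm, ← le_div_iff₀ hf]
  exact Finset.inf'_le _ hm

lemma Policy.step_rem_le (s : State Flow) (f : Flow) : (r.step s).rem f ≤ s.rem f := by
  rw [r.step_rem]
  linarith [mul_nonneg (r.rateAt_nonneg s f) (r.delay_nonneg s)]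

lemma Policy.step_rem_nonneg (s : State Flow) (f : Flow) (h : 0 ≤ s.rem f) :
    0 ≤ (r.step s).rem f := by
  rw [r.step_rem]
  rcases (r.rateAt_nonneg s f).eq_or_lt with h0 | h0
  · simpa [← h0] using h
  · linarith [r.rateAt_mul_delay_le s h0]

lemma Policy.epoch_succ (v : Flow → ℝ) (n : ℕ) : r.epoch v (n + 1) = r.step (r.epoch v n) := by
  unfold Policy.epoch
  rw [Function.iterate_succ_apply']

lemma Policy.now_monotone (v : Flow → ℝ) : Monotone fun n => (r.epoch v n).now :=
  monotone_nat_of_le_succ fun n => by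
    rw [r.epoch_succ, r.step_now]
    linarith [r.delay_nonneg (r.epoch v n)]

lemma Policy.rem_antitone (v : Flow → ℝ) (f : Flow) : Antitone fun n => (r.epoch v n).rem f :=
  antitone_nat_of_succ_le fun n => by
    rw [r.epoch_succ]
    exact r.step_rem_le _ f

lemma Policy.epoch_rem_le (v : Flow → ℝ) (f : Flow) (n : ℕ) : (r.epoch v n).rem f ≤ v f :=
  r.rem_antitone v f (Nat.zero_le n)

lemma Policy.epoch_rem_nonneg {v : Flow → ℝ} {f : Flow} (hv : 0 ≤ v f) (n : ℕ) :
    0 ≤ (r.epoch v n).rem f := by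
  induction n with
  | zero => exact hv
  | succ n ih => rw [r.epoch_succ]; exact r.step_rem_nonneg _ f ih

open Classical in
/-- The volume sent through a port is bounded by its capacity. -/
lemma Policy.sum_transmitted_le (v : Flow → ℝ) (l : Port) (n : ℕ) :
    ∑ f with N.Uses f l, (v f - (r.epoch v n).rem f) ≤ N.cap l * (r.epoch v n).now := by
  induction n with
  | zero => simp [Policy.epoch]
  | succ n ih =>
    rw [r.epoch_succ, r.step_now, mul_add]
    have h1 := mul_le_mul_of_nonneg_right
      (r.capacity (r.epoch v n).past (r.epoch v n).now (r.epoch v n).finished l)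
      (r.delay_nonneg (r.epoch v n))
    rw [Finset.sum_mul] at h1
    have h2 : ∑ f with N.Uses f l, (v f - (r.step (r.epoch v n)).rem f) =
        ∑ f with N.Uses f l, (v f - (r.epoch v n).rem f) +
          ∑ f with N.Uses f l, r.rateAt (r.epoch v n) f * r.delay (r.epoch v n) := by
      rw [← Finset.sum_add_distrib]
      refine Finset.sum_congr rfl fun f _ => ?_
      rw [r.step_rem]
      ring
    rw [h2]
    exact add_le_add ih h1

/-- The infimum in the definition of a finite completion time is attained. -/
lemma Policy.exists_epoch_of_flowCompletion_le {v : Flow → ℝ} {f : Flow} {t : ℝ≥0∞} (ht : t ≠ ∞)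
    (h : r.flowCompletion v f ≤ t) :
    ∃ n, (r.epoch v n).rem f ≤ 0 ∧ ENNReal.ofReal (r.epoch v n).now ≤ t := by
  classical
  have hex : ∃ n, (r.epoch v n).rem f ≤ 0 := by
    by_contra hne
    push Not at hne
    have : r.flowCompletion v f = ∞ := by
      unfold Policy.flowCompletion
      simp [hne]
    rw [this, top_le_iff] at h
    exact ht h
  refine ⟨Nat.find hex, Nat.find_spec hex, le_trans ?_ h⟩
  refine le_iInf₂ fun n hn => ENNReal.ofReal_le_ofReal (r.now_monotone v (Nat.find_min' hex hn))

lemma Policy.flowCompletion_le {v : Flow → ℝ} {f : Flow} {n : ℕ} (h : (r.epoch v n).rem f ≤ 0) :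
    r.flowCompletion v f ≤ ENNReal.ofReal (r.epoch v n).now :=
  iInf₂_le n h

/-- Flows of a port that are finished by time `t` need at least the time to send them one by
one. -/
lemma Policy.load_le_of_flowCompletion_le {v : Flow → ℝ} {l : Port}
    {S : Finset Flow} (hS : ∀ f ∈ S, N.Uses f l) {t : ℝ≥0∞}
    (h : ∀ f ∈ S, r.flowCompletion v f ≤ t) :
    ENNReal.ofReal ((∑ f ∈ S, v f) / N.cap l) ≤ t := by
  classical
  rcases eq_or_ne t ∞ with rfl | ht
  · exact le_top
  rcases S.eq_empty_or_nonempty with rfl | hne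
  · simp
  have hex : ∀ f ∈ S, ∃ n, (r.epoch v n).rem f ≤ 0 ∧ ENNReal.ofReal (r.epoch v n).now ≤ t :=
    fun f hf => r.exists_epoch_of_flowCompletion_le ht (h f hf)
  choose! n hn using hex
  -- At the latest of the chosen completion epochs, all of `S` has been sent.
  obtain ⟨g, hg, hmax⟩ := S.exists_max_image n hne
  refine le_trans (ENNReal.ofReal_le_ofReal ?_) (hn g hg).2
  rw [div_le_iff₀' (N.cap_pos l)]
  refine le_trans ?_ (r.sum_transmitted_le v l (n g))
  calc ∑ f ∈ S, v f ≤ ∑ f ∈ S, (v f - (r.epoch v (n g)).rem f) := by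
        refine Finset.sum_le_sum fun f hf => ?_
        have := (r.rem_antitone v f (hmax f hf)).trans (hn f hf).1
        beta_reduce at this
        linarith
    _ ≤ _ := by
        refine Finset.sum_le_sum_of_subset_of_nonneg (fun f hf => ?_) fun f _ _ => ?_
        · simpa using hS f hf
        · linarith [r.epoch_rem_le v f (n g)]

end PolicyDynamics

/-! ### Lower bounds for order-based policies. -/

section OrderBased

variable {Port Cof Flow : Type*} [Fintype Flow] (N : Network Port Cof Flow)

/-- Coflow `j` is finished at port `l` by the time coflow `k` is, in the order `prec` of the
flows. -/
def FinishedBy (prec : Flow → Flow → Prop) (l : Port) (j k : Cof) : Prop :=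
  ∃ f, N.owner f = k ∧ N.Uses f l ∧ ∀ g, N.owner g = j → N.Uses g l → g = f ∨ prec g f

variable {N}

/-- Whichever coflow owns the last flow, in the order `prec`, among the flows of `j` and `k` at `l`
is finished last there. The hypothesis on `j` ensures that such a flow exists. -/
lemma finishedBy_total {prec : Flow → Flow → Prop} [IsStrictOrder Flow prec] {l : Port}
    (hcomp : ∀ f g, f ≠ g → N.Uses f l → N.Uses g l → prec f g ∨ prec g f) {j k : Cof}
    (hj : ∃ f, N.owner f = j ∧ N.Uses f l) :
    FinishedBy N prec l j k ∨ FinishedBy N prec l k j := by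
  have hwf : WellFounded (Function.swap prec) := by
    have : IsTrans Flow (Function.swap prec) := ⟨fun a b c h1 h2 => _root_.trans (r := prec) h2 h1⟩
    have : Std.Irrefl (Function.swap prec) := ⟨fun a h => irrefl (r := prec) a h⟩
    exact Finite.wellFounded_of_trans_of_irrefl _
  obtain ⟨f0, h0, h0l⟩ := hj
  obtain ⟨m, ⟨hml, hm⟩, hmax⟩ := hwf.has_min
    {f | N.Uses f l ∧ (N.owner f = j ∨ N.owner f = k)} ⟨f0, h0l, Or.inl h0⟩
  have key : ∀ g, N.Uses g l → (N.owner g = j ∨ N.owner g = k) → g = m ∨ prec g m := by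
    intro g hgl hg
    by_cases hgm : g = m
    · exact Or.inl hgm
    · exact Or.inr ((hcomp g m hgm hgl hml).resolve_right (hmax g ⟨hgl, hg⟩))
  rcases hm with hm | hm
  · exact Or.inr ⟨m, hm, hml, fun g hg hgl => key g hgl (Or.inr hg)⟩
  · exact Or.inl ⟨m, hm, hml, fun g hg hgl => key g hgl (Or.inl hg)⟩

open Classical in
lemma sum_procTime_eq [Fintype Cof] (v : Flow → ℝ) (l : Port) (D : Finset Cof) :
    ∑ j ∈ D, N.procTime v l j = (∑ f with N.owner f ∈ D ∧ N.Uses f l, v f) / N.cap l := by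
  unfold Network.procTime
  rw [← Finset.sum_div]
  congr 1
  simp only [Finset.sum_filter, ite_and]
  rw [Finset.sum_comm]
  refine Finset.sum_congr rfl fun f _ => ?_
  rw [Finset.sum_ite_eq]

open Classical in
-- Every flow counted on the left completes no later than some flow of `k`, so the port must have
-- carried them all by then. The index set does not depend on `v`, so expectations can be taken term
-- by term.
lemma Policy.sum_procTime_le_completion [Fintype Cof] (r : Policy N) {prec : Flow → Flow → Prop}
    (hr : ∀ v : Flow → ℝ, (∀ f, 0 < v f) → ∀ f g l, N.Uses f l → N.Uses g l → prec f g →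
      r.flowCompletion v f ≤ r.flowCompletion v g) {v : Flow → ℝ} (hv : ∀ f, 0 < v f)
    (l : Port) (k : Cof) :
    ENNReal.ofReal (∑ j with FinishedBy N prec l j k, N.procTime v l j) ≤ r.completion v k := by
  rw [sum_procTime_eq]
  refine r.load_le_of_flowCompletion_le (fun f hf => ?_) fun g hg => ?_
  · simp only [Finset.mem_filter] at hf
    exact hf.2.2
  · simp only [Finset.mem_filter, Finset.mem_univ, true_and] at hg
    obtain ⟨⟨f, hfk, hfl, hf⟩, hgl⟩ := hg
    refine le_trans ?_ (le_iSup₂ (f := fun f (_ : N.owner f = k) => r.flowCompletion v f) f hfk)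
    rcases hf g rfl hgl with rfl | h
    · exact le_rfl
    · exact hr v hv g f l hgl hfl h

end OrderBased

/-! ### Completion times under the greedy allocation. -/

section Greedy

variable {Port Cof Flow : Type*} {N : Network Port Cof Flow}

lemma exists_greedyRate_pos (fs : List Flow) (h : fs ≠ []) (res : Port → ℝ)
    (hres : ∀ l, 0 < res l) : ∃ f, 0 < greedyRate N fs res f := by
  cases fs with
  | nil => exact absurd rfl h
  | cons f fs => exact ⟨f, by simp [greedyRate, hres]⟩

variable [Fintype Flow]

open Classical in
/-- Every scanned flow finds one of its ports saturated by the flows scanned up to it. -/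
lemma greedyRate_saturates (P : Flow → Prop) (fs : List Flow) (res : Port → ℝ)
    (hnd : fs.Nodup) (hP : fs.Pairwise fun g f => P f → P g) (hres : ∀ l, 0 ≤ res l) {f : Flow}
    (hf : f ∈ fs) (hfP : P f) :
    ∃ l, (l = N.src f ∨ l = N.dst f) ∧
      res l ≤ ∑ g with P g ∧ N.Uses g l, greedyRate N fs res g := by
  induction fs generalizing res with
  | nil => simp at hf
  | cons a as ih =>
    rw [List.nodup_cons] at hnd
    rw [List.pairwise_cons] at hP
    rcases List.mem_cons.1 hf with rfl | hfas
    · have hself : greedyRate N (f :: as) res f = min (res (N.src f)) (res (N.dst f)) := by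
        simp [greedyRate]
      have hle : ∀ l, N.Uses f l → min (res (N.src f)) (res (N.dst f)) ≤
          ∑ g with P g ∧ N.Uses g l, greedyRate N (f :: as) res g := fun l hl => by
        rw [← hself]
        exact Finset.single_le_sum (fun g _ => greedyRate_nonneg N _ res hres g)
          (by simpa using ⟨hfP, hl⟩)
      rcases min_choice (res (N.src f)) (res (N.dst f)) with h | h
      · exact ⟨_, Or.inl rfl, h ▸ hle _ (Or.inl rfl)⟩
      · exact ⟨_, Or.inr rfl, h ▸ hle _ (Or.inr rfl)⟩
    -- `a` is scanned before `f`, so it satisfies `P`, and the capacity it takes from a port counts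
    -- towards the saturation.
    · have haP : P a := hP.1 f hfas hfP
      obtain ⟨l, hl, hsum⟩ := ih _ hnd.2 hP.2 (fun l => residual_nonneg N a res hres l) hfas
      refine ⟨l, hl, ?_⟩
      simp only [greedyRate]
      by_cases hal : N.Uses a l
      · have hmem : a ∈ Finset.univ.filter fun g => P g ∧ N.Uses g l := by simpa using ⟨haP, hal⟩
        rw [Finset.sum_update_of_mem hmem]
        rw [if_pos hal, ← Finset.add_sum_erase _ _ hmem, greedyRate_of_notMem _ _ _ _ hnd.1,
          Finset.erase_eq] at hsum
        linarith
      · rw [Finset.sum_update_of_notMem (by simp [hal])]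
        rwa [if_neg hal] at hsum

lemma Policy.exists_step_rem_eq_zero (r : Policy N) (s : State Flow)
    (h : (r.active s).Nonempty) : ∃ f, 0 < s.rem f ∧ (r.step s).rem f = 0 := by
  obtain ⟨f, hf, hmin⟩ := Finset.exists_mem_eq_inf' h fun f => s.rem f / r.rateAt s f
  have hpos := r.mem_active.1 hf
  refine ⟨f, r.rem_pos_of_active hpos, ?_⟩
  rw [r.step_rem, Policy.delay, dif_pos h, hmin]
  field_simp
  ring

variable {order : List Flow}

lemma greedyPolicy_active_nonempty (hmem : ∀ f, f ∈ order) (s : State Flow) {f : Flow}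
    (hf : 0 < s.rem f) : ((greedyPolicy N order).active s).Nonempty := by
  classical
  have hne : order.filter (fun g => g ∉ s.finished) ≠ [] := by
    refine List.ne_nil_of_mem (a := f) (List.mem_filter.2 ⟨hmem f, ?_⟩)
    simpa [State.mem_finished] using hf
  obtain ⟨g, hg⟩ := exists_greedyRate_pos (N := N) _ hne N.cap N.cap_pos
  refine ⟨g, (Policy.mem_active _).2 ?_⟩
  unfold Policy.rateAt greedyPolicy
  convert hg

/-- Some flow completes at every epoch, so all of them complete. -/
lemma greedyPolicy_exists_finished (hmem : ∀ f, f ∈ order) (v : Flow → ℝ) (f : Flow) :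
    ∃ n, ((greedyPolicy N order).epoch v n).rem f ≤ 0 := by
  classical
  set r := greedyPolicy N order
  by_contra hne
  push Not at hne
  have key : ∀ n, n ≤ ((r.epoch v n).finished).card := by
    intro n
    induction n with
    | zero => exact Nat.zero_le _
    | succ n ih =>
      obtain ⟨g, hg, hg'⟩ := r.exists_step_rem_eq_zero _
        (greedyPolicy_active_nonempty hmem (r.epoch v n) (hne n))
      rw [← r.epoch_succ] at hg'
      refine Nat.succ_le_of_lt (ih.trans_lt (Finset.card_lt_card ?_))
      rw [Finset.ssubset_iff_of_subset]
      · exact ⟨g, State.mem_finished.2 hg'.le, fun h => absurd (State.mem_finished.1 h)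
          (not_le.2 hg)⟩
      · intro a ha
        rw [State.mem_finished] at ha ⊢
        exact (r.rem_antitone v a (Nat.le_succ n)).trans ha
  have h1 := key (Fintype.card Flow + 1)
  have h2 := Finset.card_le_univ ((r.epoch v (Fintype.card Flow + 1)).finished)
  omega

open Classical in
/-- The time until flow `f` completes is covered by the work that its two ports do for flows of at
least its priority. -/
lemma greedyPolicy_now_le (hnd : order.Nodup) (hmem : ∀ f, f ∈ order) (P : Flow → Prop)
    (hP : order.Pairwise fun g f => P f → P g) {f : Flow} (hfP : P f) (v : Flow → ℝ) (n : ℕ)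
    (hn : ∀ m < n, 0 < ((greedyPolicy N order).epoch v m).rem f) :
    ((greedyPolicy N order).epoch v n).now ≤
      (∑ g with P g ∧ N.Uses g (N.src f),
          (v g - ((greedyPolicy N order).epoch v n).rem g)) / N.cap (N.src f) +
        (∑ g with P g ∧ N.Uses g (N.dst f),
          (v g - ((greedyPolicy N order).epoch v n).rem g)) / N.cap (N.dst f) := by
  set r := greedyPolicy N order with hr
  induction n with
  | zero => simp [Policy.epoch]
  | succ n ih =>
    have ih := ih fun m hm => hn m (hm.trans (Nat.lt_succ_self n))
    set s := r.epoch v n with hs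
    have hstep : ∀ l, (∑ g with P g ∧ N.Uses g l, (v g - (r.epoch v (n + 1)).rem g)) / N.cap l =
        (∑ g with P g ∧ N.Uses g l, (v g - s.rem g)) / N.cap l +
          (∑ g with P g ∧ N.Uses g l, r.rateAt s g) * r.delay s / N.cap l := by
      intro l
      rw [← add_div, Finset.sum_mul, ← Finset.sum_add_distrib, r.epoch_succ]
      congr 1
      refine Finset.sum_congr rfl fun g _ => ?_
      rw [r.step_rem]
      ring
    have hnn : ∀ l, 0 ≤ (∑ g with P g ∧ N.Uses g l, r.rateAt s g) * r.delay s / N.cap l :=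
      fun l => div_nonneg (mul_nonneg (Finset.sum_nonneg fun g _ => r.rateAt_nonneg s g)
        (r.delay_nonneg s)) (N.cap_pos l).le
    -- The saturated port may change from epoch to epoch; adding the work of both ports covers every
    -- case.
    have hsat : ∃ l, (l = N.src f ∨ l = N.dst f) ∧
        N.cap l ≤ ∑ g with P g ∧ N.Uses g l, r.rateAt s g := by
      have hf : f ∈ order.filter (fun g => g ∉ s.finished) := by
        refine List.mem_filter.2 ⟨hmem f, ?_⟩
        simpa [State.mem_finished] using hn n (Nat.lt_succ_self n)
      exact greedyRate_saturates (N := N) P _ N.cap (hnd.filter _) (hP.filter _)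
        (fun l => (N.cap_pos l).le) hf hfP
    have hdelay : ∃ l, (l = N.src f ∨ l = N.dst f) ∧
        r.delay s ≤ (∑ g with P g ∧ N.Uses g l, r.rateAt s g) * r.delay s / N.cap l := by
      obtain ⟨l, hl, h⟩ := hsat
      refine ⟨l, hl, ?_⟩
      rw [le_div_iff₀ (N.cap_pos l), mul_comm]
      exact mul_le_mul_of_nonneg_right h (r.delay_nonneg s)
    rw [hstep, hstep, r.epoch_succ, r.step_now]
    have h1 := hnn (N.src f)
    have h2 := hnn (N.dst f)
    obtain ⟨l, rfl | rfl, h⟩ := hdelay <;> linarith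

open Classical in
-- Take for `P` the flows whose coflow has priority at least that of the owner of `f`, and bound the
-- volume sent by the whole volume.
lemma greedyPolicy_flowCompletion_le [Fintype Cof] {π : List Cof} (h : IsFlowOrder N π order)
    {v : Flow → ℝ} (hv : ∀ f, 0 < v f) (f : Flow) :
    (greedyPolicy N order).flowCompletion v f ≤ ENNReal.ofReal
      (∑ j with π.idxOf j ≤ π.idxOf (N.owner f), N.procTime v (N.src f) j +
        ∑ j with π.idxOf j ≤ π.idxOf (N.owner f), N.procTime v (N.dst f) j) := by
  obtain ⟨hnd, hmem, hord⟩ := h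
  have hex := greedyPolicy_exists_finished (N := N) hmem v f
  refine (Policy.flowCompletion_le _ (Nat.find_spec hex)).trans (ENNReal.ofReal_le_ofReal ?_)
  have hnow := greedyPolicy_now_le (N := N) hnd hmem
    (fun g => π.idxOf (N.owner g) ≤ π.idxOf (N.owner f)) (hord.imp fun h1 h2 => h1.trans h2)
    le_rfl v (Nat.find hex) fun m hm => not_le.1 (Nat.find_min hex hm)
  refine hnow.trans ?_
  rw [sum_procTime_eq, sum_procTime_eq]
  simp only [Finset.mem_filter, Finset.mem_univ, true_and]
  refine add_le_add ?_ ?_ <;>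
  · refine div_le_div_of_nonneg_right ((Finset.sum_le_sum fun g _ => (?_ : _ ≤ v g)).trans_eq
      (Finset.sum_congr (by ext; simp) fun _ _ => rfl)) (N.cap_pos _).le
    linarith [(greedyPolicy N order).epoch_rem_nonneg (hv g).le (Nat.find hex)]

end Greedy

/-! ### Expected maxima from moment generating functions. -/

section SoftMax

variable {Ω ι : Type*} [MeasurableSpace Ω] [Fintype ι] [Nonempty ι] {ν : Measure Ω}
  [IsProbabilityMeasure ν]

/-- The expected maximum of finitely many nonnegative variables is controlled by a common bound on
their moment generating functions. -/
lemma lintegral_le_of_mgf_le {X : ι → Ω → ℝ} {t q : ℝ} (ht : 0 < t) (hq : 0 < q)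
    (hX : ∀ i, ∀ᵐ ω ∂ν, 0 ≤ X i ω) (hint : ∀ i, Integrable (fun ω => Real.exp (t * X i ω)) ν)
    (hmgf : ∀ i, mgf (X i) ν t ≤ q) (Y : Ω → ℝ≥0∞) (m : ℝ) (hm : 0 ≤ m)
    (hY : ∀ᵐ ω ∂ν, ∀ u : ℝ, (∀ i, X i ω ≤ u) → Y ω ≤ ENNReal.ofReal (m * u)) :
    ∫⁻ ω, Y ω ∂ν ≤ ENNReal.ofReal (m * (Real.log (Fintype.card ι * q) / t)) := by
  set a : ℝ := Fintype.card ι * q with ha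
  have ha0 : 0 < a := mul_pos (by exact_mod_cast Fintype.card_pos) hq
  -- With S = ∑ exp(t X_i), the soft maximum log(S)/t is replaced by its tangent at S = a, where a
  -- bounds E[S]. It still dominates each X_i, and being affine in S it is integrated directly.
  set u : Ω → ℝ := fun ω => (Real.log a - 1 + (∑ i, Real.exp (t * X i ω)) / a) / t with hu
  have hXu : ∀ ω i, X i ω ≤ u ω := by
    intro ω i
    rw [hu, le_div_iff₀ ht, mul_comm]
    have h1 : Real.exp (t * X i ω) ≤ ∑ i, Real.exp (t * X i ω) :=
      Finset.single_le_sum (f := fun i => Real.exp (t * X i ω)) (fun i _ => (Real.exp_pos _).le)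
        (Finset.mem_univ i)
    have h2 := Real.add_one_le_exp (t * X i ω - Real.log a)
    rw [Real.exp_sub, Real.exp_log ha0] at h2
    have h3 := div_le_div_of_nonneg_right h1 ha0.le
    linarith
  have hu0 : ∀ᵐ ω ∂ν, 0 ≤ m * u ω := by
    filter_upwards [hX (Classical.arbitrary ι)] with ω h
    exact mul_nonneg hm (h.trans (hXu ω _))
  have hsum : Integrable (fun ω => (∑ i, Real.exp (t * X i ω)) / a) ν :=
    (integrable_finsetSum _ fun i _ => hint i).div_const a
  have hui : Integrable u ν := ((integrable_const _).add hsum).div_const t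
  calc ∫⁻ ω, Y ω ∂ν ≤ ∫⁻ ω, ENNReal.ofReal (m * u ω) ∂ν := by
        refine lintegral_mono_ae ?_
        filter_upwards [hY] with ω h
        exact h _ (hXu ω)
    _ = ENNReal.ofReal (∫ ω, m * u ω ∂ν) :=
        (ofReal_integral_eq_lintegral_ofReal (hui.const_mul m) hu0).symm
    _ ≤ _ := by
        refine ENNReal.ofReal_le_ofReal ?_
        rw [integral_const_mul]
        refine mul_le_mul_of_nonneg_left ?_ hm
        rw [hu, integral_div, integral_add (integrable_const _) hsum, integral_div,
          integral_finsetSum _ fun i _ => hint i]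
        refine div_le_div_of_nonneg_right ?_ ht.le
        have h1 : ∑ i, ∫ ω, Real.exp (t * X i ω) ∂ν ≤ a := by
          refine (Finset.sum_le_sum fun i _ => hmgf i).trans ?_
          simp [ha]
        have h2 := (div_le_one ha0).2 h1
        simp only [integral_const, probReal_univ, one_smul]
        linarith

end SoftMax

/-! ### The explicit constant. -/

section Numeric

/-- The left side is arsinh √(c² - 1), and arsinh x ≤ x for x ≥ 0. -/
lemma log_add_sqrt_le {c : ℝ} (hc : 1 < c) :
    Real.log (c + Real.sqrt (c ^ 2 - 1)) ≤ Real.sqrt (c ^ 2 - 1) := by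
  set t := Real.sqrt (c ^ 2 - 1) with ht
  have h1 : 0 ≤ c ^ 2 - 1 := by nlinarith
  have h2 : Real.sqrt (1 + t ^ 2) = c := by
    rw [ht, Real.sq_sqrt h1, add_sub_cancel, Real.sqrt_sq (by linarith)]
  have h3 : Real.arsinh t ≤ t := by
    have := Real.arsinh_le_arsinh.2 (Real.self_le_sinh_iff.2 (Real.sqrt_nonneg (c ^ 2 - 1)))
    rwa [Real.arsinh_sinh] at this
  rwa [Real.arsinh, h2, add_comm] at h3

/-- The choice of the exponent in the bound on the expected maximum. -/
lemma log_mul_rpow_div_le {c z b M L t : ℝ} (hc : 1 < c) (hz : z = c + Real.sqrt (c ^ 2 - 1))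
    (hb : 0 < b) (hM : 0 < M) (hL : 0 < L) (hbL : b * Real.log L ≤ M * (c - 1))
    (ht : t = (1 - 1 / z) / b) :
    Real.log (L * (1 - b * t) ^ (-M / b)) / t ≤ M * (c + Real.log z) := by
  have hs := log_add_sqrt_le hc
  rw [← hz] at hs
  have hz1 : 1 < z := by rw [hz]; linarith [Real.sqrt_nonneg (c ^ 2 - 1)]
  have hz0 : 0 < z := by linarith
  have e1 : 1 - b * t = z⁻¹ := by rw [ht]; field_simp; ring
  have e2 : Real.log (L * (1 - b * t) ^ (-M / b)) = (b * Real.log L + M * Real.log z) / b := by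
    rw [e1, Real.log_mul hL.ne' (Real.rpow_pos_of_pos (inv_pos.2 hz0) _).ne',
      Real.log_rpow (inv_pos.2 hz0), Real.log_inv]
    field_simp
  have e3 : t = (z - 1) / (z * b) := by rw [ht]; field_simp
  have ht0 : 0 < t := by rw [e3]; exact div_pos (by linarith) (by positivity)
  -- After expansion this says log z ≤ z - c, which is `hs`.
  have key : z * (c - 1 + Real.log z) ≤ (c + Real.log z) * (z - 1) := by linarith
  rw [div_le_iff₀ ht0, e2, e3, ← mul_div_assoc, div_le_div_iff₀ hb (by positivity)]
  have h1 := mul_le_mul_of_nonneg_left hbL hz0.le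
  have h2 := mul_le_mul_of_nonneg_left key hM.le
  nlinarith

end Numeric

/-! ### Processing times with gamma laws. -/

section ProcessingTimes

variable {Port Cof Flow Ω : Type*} [Fintype Flow] [MeasurableSpace Ω] {ν : Measure Ω}
  {N : Network Port Cof Flow} {V : Flow → Ω → ℝ}

/-- Every nontrivial processing time is gamma-distributed. -/
def GammaTimes (N : Network Port Cof Flow) (ν : Measure Ω) (V : Flow → Ω → ℝ) : Prop :=
  ∀ l k, (∃ f, N.owner f = k ∧ N.Uses f l) → ∃ s β : ℝ, 0 < s ∧ 0 < β ∧
    ν.map (fun ω => N.procTime (fun f => V f ω) l k) = gammaMeasure s (1 / β)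

lemma measurable_procTime (hV : ∀ f, Measurable (V f)) (l : Port) (k : Cof) :
    Measurable fun ω => N.procTime (fun f => V f ω) l k := by
  unfold Network.procTime
  exact (Finset.measurable_sum _ fun f _ => hV f).div_const _

lemma procTime_nonneg {v : Flow → ℝ} (hv : ∀ f, 0 < v f) (l : Port) (k : Cof) :
    0 ≤ N.procTime v l k :=
  div_nonneg (Finset.sum_nonneg fun f _ => (hv f).le) (N.cap_pos l).le

lemma procTime_eq_zero {l : Port} {k : Cof} (h : ¬∃ f, N.owner f = k ∧ N.Uses f l)
    (v : Flow → ℝ) : N.procTime v l k = 0 := by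
  classical
  unfold Network.procTime
  rw [Finset.sum_eq_zero, zero_div]
  intro f hf
  exact absurd ⟨f, by simpa using hf⟩ h

lemma GammaTimes.integrable (h : GammaTimes N ν V) (hV : ∀ f, Measurable (V f)) (l : Port)
    (k : Cof) : Integrable (fun ω => N.procTime (fun f => V f ω) l k) ν := by
  by_cases hu : ∃ f, N.owner f = k ∧ N.Uses f l
  · obtain ⟨s, β, hs, hβ, hmap⟩ := h l k hu
    exact integrable_of_map_gamma (measurable_procTime hV l k) hs hβ hmap
  · simp [procTime_eq_zero hu]

lemma meanTime_eq_zero {l : Port} {k : Cof} (h : ¬∃ f, N.owner f = k ∧ N.Uses f l) :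
    meanTime N ν V l k = 0 := by
  simp [meanTime, procTime_eq_zero h]

lemma GammaTimes.meanTime_pos (h : GammaTimes N ν V) (hV : ∀ f, Measurable (V f)) {l : Port}
    {k : Cof} (hu : ∃ f, N.owner f = k ∧ N.Uses f l) : 0 < meanTime N ν V l k := by
  obtain ⟨s, β, hs, hβ, hmap⟩ := h l k hu
  rw [meanTime, integral_of_map_gamma (measurable_procTime hV l k) hs hβ hmap]
  positivity

lemma GammaTimes.meanTime_nonneg (h : GammaTimes N ν V) (hV : ∀ f, Measurable (V f)) (l : Port)
    (k : Cof) : 0 ≤ meanTime N ν V l k := by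
  by_cases hu : ∃ f, N.owner f = k ∧ N.Uses f l
  · exact (h.meanTime_pos hV hu).le
  · rw [meanTime_eq_zero hu]

variable [Fintype Port] [Fintype Cof]

lemma finite_meanTime : {m | ∃ l k, m = meanTime N ν V l k ∧ m ≠ 0}.Finite := by
  refine (Set.finite_range fun p : Port × Cof => meanTime N ν V p.1 p.2).subset ?_
  rintro m ⟨l, k, rfl, -⟩
  exact ⟨(l, k), rfl⟩

lemma minMean_le {l : Port} {k : Cof} (h : meanTime N ν V l k ≠ 0) :
    minMean N ν V ≤ meanTime N ν V l k :=
  csInf_le finite_meanTime.bddBelow ⟨l, k, rfl, h⟩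

lemma variance_le_maxVariance (l : Port) (k : Cof) :
    variance (fun ω => N.procTime (fun f => V f ω) l k) ν ≤ maxVariance N ν V := by
  refine le_csSup (Set.Finite.bddAbove ?_) ⟨l, k, rfl⟩
  refine (Set.finite_range fun p : Port × Cof =>
    variance (fun ω => N.procTime (fun f => V f ω) p.1 p.2) ν).subset ?_
  rintro m ⟨l, k, rfl⟩
  exact ⟨(l, k), rfl⟩

/-- The infimum is over a finite nonempty set, so it is one of the nonzero means. -/
lemma GammaTimes.minMean_pos [Nonempty Flow] (h : GammaTimes N ν V)
    (hV : ∀ f, Measurable (V f)) : 0 < minMean N ν V := by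
  have f : Flow := Classical.arbitrary Flow
  have hne : {m | ∃ l k, m = meanTime N ν V l k ∧ m ≠ 0}.Nonempty :=
    ⟨meanTime N ν V (N.src f) (N.owner f), N.src f, N.owner f, rfl,
      (h.meanTime_pos hV ⟨f, rfl, Or.inl rfl⟩).ne'⟩
  obtain ⟨l, k, hm, hm0⟩ := hne.csInf_mem finite_meanTime
  change minMean N ν V = _ at hm
  refine lt_of_le_of_ne ?_ (Ne.symm hm0)
  rw [hm]
  exact h.meanTime_nonneg hV l k

lemma GammaTimes.maxVariance_pos [Nonempty Flow] [IsProbabilityMeasure ν]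
    (h : GammaTimes N ν V) (hV : ∀ f, Measurable (V f)) : 0 < maxVariance N ν V := by
  have f : Flow := Classical.arbitrary Flow
  obtain ⟨s, β, hs, hβ, hmap⟩ := h (N.src f) (N.owner f) ⟨f, rfl, Or.inl rfl⟩
  refine lt_of_lt_of_le ?_ (variance_le_maxVariance (N.src f) (N.owner f))
  rw [variance_of_map_gamma (measurable_procTime hV _ _) hs hβ hmap]
  positivity

/-- The moment generating function of a processing time, bounded by that of a gamma variable with
the same mean and the largest possible scale. -/
lemma GammaTimes.mgf_procTime_le [Nonempty Flow] [IsProbabilityMeasure ν]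
    (h : GammaTimes N ν V) (hV : ∀ f, Measurable (V f)) {b t : ℝ}
    (hb : b = maxVariance N ν V / minMean N ν V) (ht0 : 0 ≤ t) (ht : b * t < 1) (l : Port)
    (k : Cof) :
    Integrable (fun ω => Real.exp (t * N.procTime (fun f => V f ω) l k)) ν ∧
      mgf (fun ω => N.procTime (fun f => V f ω) l k) ν t ≤
        (1 - b * t) ^ (-meanTime N ν V l k / b) := by
  by_cases hu : ∃ f, N.owner f = k ∧ N.Uses f l
  · obtain ⟨s, β, hs, hβ, hmap⟩ := h l k hu
    have hm := measurable_procTime (N := N) hV l k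
    -- The scale is variance over mean, sβ²/(sβ).
    have hβb : β ≤ b := by
      rw [hb, le_div_iff₀ (h.minMean_pos hV)]
      have h1 := variance_le_maxVariance (N := N) (ν := ν) (V := V) l k
      have h2 := minMean_le (h.meanTime_pos hV hu).ne'
      rw [meanTime, integral_of_map_gamma hm hs hβ hmap] at h2
      rw [variance_of_map_gamma hm hs hβ hmap] at h1
      nlinarith [mul_le_mul_of_nonneg_left h2 hβ.le]
    exact ⟨(mgf_of_map_gamma hm hs hβ hmap
        ((mul_le_mul_of_nonneg_right hβb ht0).trans_lt ht)).1,
      mgf_gamma_le_of_scale_le hm hs hβ hmap hβb ht0 ht⟩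
  · rw [meanTime_eq_zero hu]
    simp [procTime_eq_zero hu, mgf]

/-- With the common scale `b` all factors are powers of the same base, so the exponents add up to a
mean load. -/
lemma GammaTimes.mgf_sum_procTime_le [Nonempty Flow] [IsProbabilityMeasure ν]
    (h : GammaTimes N ν V) (hV : ∀ f, Measurable (V f)) {b t : ℝ}
    (hb : b = maxVariance N ν V / minMean N ν V) (ht0 : 0 ≤ t) (ht : b * t < 1) (l : Port)
    (hindep : iIndepFun (fun (k : Cof) ω => N.procTime (fun f => V f ω) l k) ν)
    (D : Finset Cof) {M : ℝ} (hM : ∑ j ∈ D, meanTime N ν V l j ≤ M) :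
    Integrable (fun ω => Real.exp (t * ∑ j ∈ D, N.procTime (fun f => V f ω) l j)) ν ∧
      mgf (fun ω => ∑ j ∈ D, N.procTime (fun f => V f ω) l j) ν t ≤ (1 - b * t) ^ (-M / b) := by
  have hb0 : 0 < b := hb ▸ div_pos (h.maxVariance_pos hV) (h.minMean_pos hV)
  have hm := fun k => measurable_procTime (N := N) hV l k
  have hfun : (∑ j ∈ D, fun ω => N.procTime (fun f => V f ω) l j) =
      fun ω => ∑ j ∈ D, N.procTime (fun f => V f ω) l j := by
    ext ω
    simp
  constructor
  · have := hindep.integrable_exp_mul_sum hm (s := D) (t := t)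
      fun j _ => (h.mgf_procTime_le hV hb ht0 ht l j).1
    rwa [hfun] at this
  · rw [← hfun, hindep.mgf_sum hm]
    calc ∏ j ∈ D, mgf (fun ω => N.procTime (fun f => V f ω) l j) ν t
        ≤ ∏ j ∈ D, (1 - b * t) ^ (-meanTime N ν V l j / b) :=
          Finset.prod_le_prod (fun _ _ => mgf_nonneg) fun j _ =>
            (h.mgf_procTime_le hV hb ht0 ht l j).2
      _ = (1 - b * t) ^ (∑ j ∈ D, -meanTime N ν V l j / b) :=
          (Real.rpow_sum_of_pos (by linarith) _ D).symm
      -- The base 1 - bt is at most 1, so replacing the mean load by its bound `M` increases the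
      -- power.
      _ ≤ _ := by
          refine Real.rpow_le_rpow_of_exponent_ge (by linarith) ?_ ?_
          · linarith [mul_nonneg hb0.le ht0]
          · rw [← Finset.sum_div, Finset.sum_neg_distrib]
            exact div_le_div_of_nonneg_right (neg_le_neg hM) hb0.le

end ProcessingTimes

/-! ### Comparison of the two policies. -/

section Approximation

variable {Port Cof Flow Ω : Type*} [Fintype Flow] [MeasurableSpace Ω] {ν : Measure Ω}
  {N : Network Port Cof Flow} {V : Flow → Ω → ℝ} [Fintype Cof]

open Classical in
/-- Expected completion times under an order-based policy. -/
lemma GammaTimes.le_lintegral_completion (h : GammaTimes N ν V) (hV : ∀ f, Measurable (V f))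
    (hVpos : ∀ f, ∀ᵐ ω ∂ν, 0 < V f ω) (r : Policy N) {prec : Flow → Flow → Prop}
    (hr : ∀ v : Flow → ℝ, (∀ f, 0 < v f) → ∀ f g l, N.Uses f l → N.Uses g l → prec f g →
      r.flowCompletion v f ≤ r.flowCompletion v g) (l : Port) (k : Cof) :
    ENNReal.ofReal (∑ j with FinishedBy N prec l j k, meanTime N ν V l j) ≤
      ∫⁻ ω, r.completion (fun f => V f ω) k ∂ν := by
  have hpos : ∀ᵐ ω ∂ν, ∀ f, 0 < V f ω := ae_all_iff.2 hVpos
  have hsum : ∑ j with FinishedBy N prec l j k, meanTime N ν V l j =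
      ∫ ω, ∑ j with FinishedBy N prec l j k, N.procTime (fun f => V f ω) l j ∂ν :=
    (integral_finsetSum _ fun j _ => h.integrable hV l j).symm
  rw [hsum, ofReal_integral_eq_lintegral_ofReal
    (integrable_finsetSum _ fun j _ => h.integrable hV l j)]
  · refine lintegral_mono_ae ?_
    filter_upwards [hpos] with ω hω
    exact r.sum_procTime_le_completion hr hω l k
  · filter_upwards [hpos] with ω hω
    exact Finset.sum_nonneg fun j _ => procTime_nonneg hω l j

variable [Fintype Port]

open Classical in
/-- Expected completion times under the greedy policy. -/
lemma GammaTimes.lintegral_completion_greedy_le [IsProbabilityMeasure ν] (h : GammaTimes N ν V)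
    (hV : ∀ f, Measurable (V f)) (hVpos : ∀ f, ∀ᵐ ω ∂ν, 0 < V f ω)
    (hindep : ∀ l, iIndepFun (fun (k : Cof) ω => N.procTime (fun f => V f ω) l k) ν)
    {π : List Cof} {order : List Flow} (horder : IsFlowOrder N π order) {c : ℝ} (hc1 : 1 < c)
    (hc : c = 1 + gammaParam N ν V * Real.log (Fintype.card Port)) (k : Cof) {M : ℝ}
    (hM : ∀ l, ∑ j with π.idxOf j ≤ π.idxOf k, meanTime N ν V l j ≤ M) :
    ∫⁻ ω, (greedyPolicy N order).completion (fun f => V f ω) k ∂ν ≤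
      ENNReal.ofReal (2 * (M * (c + Real.log (c + Real.sqrt (c ^ 2 - 1))))) := by
  obtain ⟨f₀, hf₀⟩ := N.owner_surjective k
  have : Nonempty Flow := ⟨f₀⟩
  have : Nonempty Port := ⟨N.src f₀⟩
  have hv0 := h.maxVariance_pos hV
  have hm0 := h.minMean_pos hV
  obtain ⟨b, hb⟩ : ∃ b, b = maxVariance N ν V / minMean N ν V := ⟨_, rfl⟩
  obtain ⟨z, hz⟩ : ∃ z, z = c + Real.sqrt (c ^ 2 - 1) := ⟨_, rfl⟩
  obtain ⟨t, ht⟩ : ∃ t, t = (1 - 1 / z) / b := ⟨_, rfl⟩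
  have hb0 : 0 < b := hb ▸ div_pos hv0 hm0
  have hz1 : 1 < z := by rw [hz]; linarith [Real.sqrt_nonneg (c ^ 2 - 1)]
  have hzi : 1 / z < 1 := (div_lt_one (by linarith)).2 hz1
  have hzi0 : 0 < 1 / z := by positivity
  have ht0 : 0 < t := by rw [ht]; exact div_pos (by linarith) hb0
  have hbt : b * t < 1 := by
    rw [ht, mul_div_cancel₀ _ hb0.ne']
    linarith
  have hL : (0 : ℝ) < Fintype.card Port := by exact_mod_cast Fintype.card_pos
  -- The prefix contains `k` itself, whose mean at an ingress port it uses is nonzero. With b =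
  -- μ_min γ this yields b log L ≤ M (c - 1).
  have hmM : minMean N ν V ≤ M := by
    refine (minMean_le (h.meanTime_pos hV ⟨f₀, hf₀, Or.inl rfl⟩).ne').trans (le_trans ?_
      (hM (N.src f₀)))
    exact Finset.single_le_sum (fun j _ => h.meanTime_nonneg hV _ j) (by simp)
  have hbL : b * Real.log (Fintype.card Port) ≤ M * (c - 1) := by
    have hlog : 0 ≤ Real.log (Fintype.card Port) :=
      Real.log_nonneg (by exact_mod_cast Fintype.card_pos)
    have hγ : b = minMean N ν V * gammaParam N ν V := by
      rw [hb, gammaParam]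
      field_simp
    have hγ0 : 0 ≤ gammaParam N ν V := div_nonneg hv0.le (sq_nonneg _)
    rw [hc, add_sub_cancel_left, hγ, mul_assoc]
    exact mul_le_mul_of_nonneg_right hmM (mul_nonneg hγ0 hlog)
  have hpos : ∀ᵐ ω ∂ν, ∀ f, 0 < V f ω := ae_all_iff.2 hVpos
  have hmgf := fun l => h.mgf_sum_procTime_le hV hb ht0.le hbt l (hindep l)
    (Finset.univ.filter fun j => π.idxOf j ≤ π.idxOf k) (hM l)
  refine (lintegral_le_of_mgf_le ht0 (Real.rpow_pos_of_pos (by linarith) _) (fun l => ?_)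
    (fun l => (hmgf l).1) (fun l => (hmgf l).2) _ 2 zero_le_two ?_).trans
    (ENNReal.ofReal_le_ofReal (mul_le_mul_of_nonneg_left ?_ zero_le_two))
  · filter_upwards [hpos] with ω hω
    exact Finset.sum_nonneg fun j _ => procTime_nonneg hω l j
  · filter_upwards [hpos] with ω hω u hu
    refine iSup₂_le fun f hf => (greedyPolicy_flowCompletion_le horder hω f).trans
      (ENNReal.ofReal_le_ofReal ?_)
    rw [hf]
    linarith [hu (N.src f), hu (N.dst f)]
  · rw [← hz]
    exact log_mul_rpow_div_le hc1 hz hb0 (hm0.trans_le hmM) hL hbL ht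

/-- A flow has two distinct ports, so L ≥ 2, and γ > 0. Strictness makes z > 1 and hence t > 0 in
the exponential bound. -/
lemma one_lt_of_gammaParam [IsProbabilityMeasure ν] [Nonempty Flow] (h : GammaTimes N ν V)
    (hV : ∀ f, Measurable (V f)) :
    1 < 1 + gammaParam N ν V * Real.log (Fintype.card Port) := by
  have f : Flow := Classical.arbitrary Flow
  have hγ : 0 < gammaParam N ν V := div_pos (h.maxVariance_pos hV) (pow_pos (h.minMean_pos hV) 2)
  have hcard : 1 < Fintype.card Port :=
    Fintype.one_lt_card_iff.2 ⟨N.src f, N.dst f, N.src_ne_dst f f⟩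
  have := mul_pos hγ (Real.log_pos (Nat.one_lt_cast.2 hcard))
  linarith

open Classical in
/-- The comparison of the greedy policy in the Sincronia order with one order-based policy. -/
lemma GammaTimes.cost_greedy_le [IsProbabilityMeasure ν] [Nonempty Flow] (h : GammaTimes N ν V)
    (hV : ∀ f, Measurable (V f)) (hVpos : ∀ f, ∀ᵐ ω ∂ν, 0 < V f ω)
    (hindep : ∀ l, iIndepFun (fun (k : Cof) ω => N.procTime (fun f => V f ω) l k) ν)
    {π : List Cof} (hπ : SincroniaRun (meanTime N ν V) N.weight Finset.univ π)
    {order : List Flow} (horder : IsFlowOrder N π order) {c : ℝ}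
    (hc : c = 1 + gammaParam N ν V * Real.log (Fintype.card Port)) (r : Policy N)
    (hr : r.IsOrderBased) :
    (greedyPolicy N order).cost ν V ≤
      ENNReal.ofReal (4 * (c + Real.log (c + Real.sqrt (c ^ 2 - 1)))) * r.cost ν V := by
  have : Nonempty Port := ⟨N.src (Classical.arbitrary Flow)⟩
  have hc1 : 1 < c := hc ▸ one_lt_of_gammaParam h hV
  have hμ := h.meanTime_nonneg hV
  obtain ⟨K, hK⟩ : ∃ K, K = c + Real.log (c + Real.sqrt (c ^ 2 - 1)) := ⟨_, rfl⟩
  have hK0 : 0 ≤ K := by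
    have : 0 ≤ Real.log (c + Real.sqrt (c ^ 2 - 1)) :=
      Real.log_nonneg (by linarith [Real.sqrt_nonneg (c ^ 2 - 1)])
    linarith
  rw [← hK]
  obtain ⟨-, prec, hso, hcomp, hcompl⟩ := hr
  choose p hp using fun k => Finite.exists_max
    fun l => ∑ j with π.idxOf j ≤ π.idxOf k, meanTime N ν V l j
  -- Maximizing over ports makes the single vector `T` satisfy the parallel inequalities at all
  -- ports at once.
  choose q hq using fun k => Finite.exists_max
    fun l => ∑ j with FinishedBy N prec l j k, meanTime N ν V l j
  set M : Cof → ℝ := fun k => ∑ j with π.idxOf j ≤ π.idxOf k, meanTime N ν V (p k) j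
  set T : Cof → ℝ := fun k => ∑ j with FinishedBy N prec (q k) j k, meanTime N ν V (q k) j
  have hM0 : ∀ k, 0 ≤ M k := fun k => Finset.sum_nonneg fun j _ => hμ _ j
  have hT0 : ∀ k, 0 ≤ T k := fun k => Finset.sum_nonneg fun j _ => hμ _ j
  have hwMT : ∑ k, N.weight k * M k ≤ 2 * ∑ k, N.weight k * T k := by
    refine hπ.weighted_load_le hμ (fun k _ => N.weight_nonneg k) T M (fun l B => ?_)
      fun k _ => ⟨p k, le_rfl⟩
    refine sq_sum_le_two_mul_sum_partial _ (hμ l) (FinishedBy N prec l) (fun j k hj _ => ?_) T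
      (fun k => hq k l) B
    refine finishedBy_total (fun f g hne hf hg => hcomp f g l hne hf hg) ?_
    by_contra hu
    exact hj.ne' (meanTime_eq_zero hu)
  calc (greedyPolicy N order).cost ν V
      ≤ ∑ k, ENNReal.ofReal (N.weight k) * ENNReal.ofReal (2 * (M k * K)) := by
        refine Finset.sum_le_sum fun k _ => mul_le_mul_right ?_ _
        rw [hK]
        exact h.lintegral_completion_greedy_le hV hVpos hindep horder hc1 hc k (hp k)
    _ = ENNReal.ofReal (2 * K * ∑ k, N.weight k * M k) := by
        rw [Finset.mul_sum, ENNReal.ofReal_sum_of_nonneg fun k _ =>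
          mul_nonneg (by linarith) (mul_nonneg (N.weight_nonneg k) (hM0 k))]
        refine Finset.sum_congr rfl fun k _ => ?_
        rw [← ENNReal.ofReal_mul (N.weight_nonneg k)]
        congr 1
        ring
    _ ≤ ENNReal.ofReal (4 * K * ∑ k, N.weight k * T k) := by
        refine ENNReal.ofReal_le_ofReal ?_
        nlinarith [mul_le_mul_of_nonneg_left hwMT hK0]
    _ = ENNReal.ofReal (4 * K) * ∑ k, ENNReal.ofReal (N.weight k) * ENNReal.ofReal (T k) := by
        rw [ENNReal.ofReal_mul (by linarith), ENNReal.ofReal_sum_of_nonneg fun k _ =>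
          mul_nonneg (N.weight_nonneg k) (hT0 k)]
        congr 1
        exact Finset.sum_congr rfl fun k _ => ENNReal.ofReal_mul (N.weight_nonneg k)
    _ ≤ _ := by
        refine mul_le_mul_right (Finset.sum_le_sum fun k _ => mul_le_mul_right ?_ _) _
        exact h.le_lintegral_completion hV hVpos r hcompl (q k) k

end Approximation

end Coflow

end

theorem mainTheorem6 {Port Cof Flow Ω : Type*} [Fintype Port] [Fintype Cof] [DecidableEq Cof]
    [Fintype Flow] [MeasurableSpace Ω] (ν : Measure Ω) [IsProbabilityMeasure ν]
    (N : Coflow.Network Port Cof Flow)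
    (V : Flow → Ω → ℝ) (hV : ∀ f, Measurable (V f)) (hVpos : ∀ f, ∀ᵐ ω ∂ν, 0 < V f ω)
    (hindep : ∀ l, iIndepFun (fun (k : Cof) ω => N.procTime (fun f => V f ω) l k) ν)
    (hgamma : ∀ l k, (∃ f, N.owner f = k ∧ N.Uses f l) →
      ∃ s β : ℝ, 0 < s ∧ 0 < β ∧
        ν.map (fun ω => N.procTime (fun f => V f ω) l k) = gammaMeasure s (1 / β))
    (π : List Cof)
    (hπ : Coflow.SincroniaRun (Coflow.meanTime N ν V) N.weight Finset.univ π)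
    (order : List Flow) (horder : Coflow.IsFlowOrder N π order)
    (c : ℝ) (hc : c = 1 + Coflow.gammaParam N ν V * Real.log (Fintype.card Port)) :
    (Coflow.greedyPolicy N order).cost ν V ≤
      ENNReal.ofReal (4 * (c + Real.log (c + Real.sqrt (c ^ 2 - 1)))) *
        Coflow.optCost N ν V := by
  classical
  rcases isEmpty_or_nonempty Flow with hF | hF
  · have : IsEmpty Cof := N.owner_surjective.isEmpty
    simp [Coflow.Policy.cost]
  -- `idxOf` in `horder` uses the given instance, while the lemmas use the classical one.
  obtain rfl : ‹DecidableEq Cof› = fun a b => Classical.propDecidable (a = b) :=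
    Subsingleton.elim _ _
  have h : Coflow.GammaTimes N ν V := hgamma
  have hc1 : 1 < c := hc ▸ Coflow.one_lt_of_gammaParam h hV
  have hK : 0 < 4 * (c + Real.log (c + Real.sqrt (c ^ 2 - 1))) := by
    have : 0 ≤ Real.log (c + Real.sqrt (c ^ 2 - 1)) :=
      Real.log_nonneg (by linarith [Real.sqrt_nonneg (c ^ 2 - 1)])
    linarith
  -- The constant is positive and finite, so it can be moved across to leave the infimum alone on
  -- the right.
  rw [← ENNReal.div_le_iff' (ENNReal.ofReal_pos.2 hK).ne' ENNReal.ofReal_ne_top]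
  refine le_iInf₂ fun r hr => ?_
  rw [ENNReal.div_le_iff' (ENNReal.ofReal_pos.2 hK).ne' ENNReal.ofReal_ne_top]
  exact h.cost_greedy_le hV hVpos hindep hπ horder hc r hr
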